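/- Call a pair $(X,Y)$ of random variables on a probability space $(\Omega,\mathcal F,\mathbb P)$ coherent if there are an event $A\in\mathcal F$ and sub-$\sigma$-fields $\mathcal G,\mathcal H\subset\mathcal F$ with $X=\mathbb P(A\mid\mathcal G)$ and $Y=\mathbb P(A\mid\mathcal H)$ almost surely. Let $\mathcal C_{\mathcal I}$ be the family of coherent pairs $(X,Y)$, over all probability spaces, for which $X$ and $Y$ are independent. For a positive integer $n$ let $\mathcal B(n,n)$ be the set of bipartite graphs with vertex set $\{x_1,\dots,x_n\}\cup\{y_1,\dots,y_n\}$ ($2n$ distinct vertices) in which every edge joins some $x_i$ to some $y_j$. Then for every integer $k\ge 3$, $$\sup_{(X,Y)\in\mathcal C_{\mathcal I}}\mathbb E|X-Y|^{k}\;=\;\sup_{n\ge 1}\ \sup_{\mathcal B(n,n)}\ \frac{1}{n^{2+k}}\sum_{i,j=1}^{n}|\deg(x_i)-\deg(y_j)|^{k},$$ where both suprema are finite. -/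

import Mathlib

open MeasureTheory ProbabilityTheory

universe u

/-- The pair of random variables `(X, Y)` on the probability space `(Ω, P)` is coherent: for some
event `A` and some sub-σ-fields `𝓖`, `𝓗`, they are versions of `P(A | 𝓖)` and `P(A | 𝓗)`,
that is, of the conditional expectations of the indicator of `A`. -/
def IsCoherent {Ω : Type u} [mΩ : MeasurableSpace Ω] (P : Measure Ω) (X Y : Ω → ℝ) : Prop :=
  Measurable X ∧ Measurable Y ∧
    ∃ (A : Set Ω) (𝓖 𝓗 : MeasurableSpace Ω), MeasurableSet[mΩ] A ∧ 𝓖 ≤ mΩ ∧ 𝓗 ≤ mΩ ∧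
      X =ᵐ[P] P[A.indicator (fun _ => (1 : ℝ)) | 𝓖] ∧
      Y =ᵐ[P] P[A.indicator (fun _ => (1 : ℝ)) | 𝓗]

/-- The values `𝔼|X - Y|^k`, over all probability spaces (in the universe `u`) and all coherent
pairs `(X, Y)` on them with `X` and `Y` independent. -/
def indepCoherentMoments (k : ℕ) : Set ℝ :=
  {v | ∃ (Ω : Type u) (_ : MeasurableSpace Ω) (P : Measure Ω) (_ : IsProbabilityMeasure P)
      (X Y : Ω → ℝ), IsCoherent P X Y ∧ IndepFun X Y P ∧ v = ∫ ω, |X ω - Y ω| ^ k ∂P}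

/-- The bipartite graphs on two disjoint groups of `n` vertices: `x i = Sum.inl i` and
`y j = Sum.inr j`. -/
def bipartiteGraphs (n : ℕ) : Set (SimpleGraph (Fin n ⊕ Fin n)) :=
  {G | G.IsBipartiteWith (Set.range Sum.inl) (Set.range Sum.inr)}

open scoped Classical in
/-- The functional `n^{-(2+k)} ∑_{i,j} |deg(x_i) - deg(y_j)|^k`. -/
noncomputable def degreeSpread (k n : ℕ) (G : SimpleGraph (Fin n ⊕ Fin n)) : ℝ :=
  1 / (n : ℝ) ^ (2 + k) *
    ∑ i : Fin n, ∑ j : Fin n, |(G.degree (Sum.inl i) : ℝ) - (G.degree (Sum.inr j) : ℝ)| ^ k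

/-! Lower bound: a bipartite graph on `n + n` vertices is an event in the square of the uniform law
on `n` points. Its conditional probabilities given either coordinate are the degrees divided by `n`,
and the two coordinates are independent, so the graph functional is itself a moment
(`degreeSpread_mem_indepCoherentMoments`).

Upper bound: by independence the law of `(X, Y)` is a product `μ ⊗ ν`, and `P(A | X, Y) = f(X, Y)`
with `f` valued in `[0, 1]` and with partial averages `X` and `Y`. Sample `n` row points `s_i` from
`μ` and `n` column points `t_j` from `ν`, and form the matrix `f(s_i, t_j)`. Given `s_i` and `t_j`,
the `i`-th row sum minus the `j`-th column sum has mean `(n - 1)(s_i - t_j)`, the shared entry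
cancelling. Jensen's inequality then bounds the expected spread of the matrix below by `n² (n - 1)^k
𝔼|X - Y|^k` (`integral_abs_row_sub_column_ge`). The spread is convex in the matrix, hence for every
sample it is at most its value at some 0/1 matrix, that is, at a graph
(`exists_bipartiteGraph_rowColumnSpread_le`). Thus `(1 - 1/n)^k 𝔼|X - Y|^k` is at most any bound `S`
on the graph functional, and `n → ∞` concludes. -/

/-! ### Row and column sums of matrices, and bipartite graphs as extreme points -/

section Graphs

/-- The sum `∑_{i,j} |r_i - c_j|^k` over the row sums `r_i` and the column sums `c_j` of a square
matrix. -/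
def rowColumnSpread (k : ℕ) {n : ℕ} (W : Fin n × Fin n → ℝ) : ℝ :=
  ∑ i, ∑ j, |∑ j', W (i, j') - ∑ i', W (i', j)| ^ k

lemma convexOn_finset_sum {E ι : Type*} [AddCommGroup E] [Module ℝ E] {t : Set E}
    (ht : Convex ℝ t) (s : Finset ι) {f : ι → E → ℝ} (hf : ∀ i ∈ s, ConvexOn ℝ t (f i)) :
    ConvexOn ℝ t (fun x => ∑ i ∈ s, f i x) := by
  classical
  induction s using Finset.induction_on with
  | empty => simpa using convexOn_const (0 : ℝ) ht
  | insert a s ha ih =>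
    simp only [Finset.sum_insert ha]
    exact (hf a (by simp)).add (ih fun i hi => hf i (by simp [hi]))

lemma convexOn_rowColumnSpread (k n : ℕ) :
    ConvexOn ℝ Set.univ (rowColumnSpread k : (Fin n × Fin n → ℝ) → ℝ) := by
  refine convexOn_finset_sum convex_univ _ fun i _ => convexOn_finset_sum convex_univ _ fun j _ => ?_
  refine ConvexOn.pow (f := fun W : Fin n × Fin n → ℝ => |∑ j', W (i, j') - ∑ i', W (i', j)|) ?_
    (fun _ _ => abs_nonneg _) k
  refine ⟨convex_univ, fun V _ W _ a b ha hb _ => ?_⟩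
  simp only [Pi.add_apply, Pi.smul_apply, smul_eq_mul, Finset.sum_add_distrib, ← Finset.mul_sum]
  refine le_trans (le_of_eq ?_) ((abs_add_le (a * (∑ j', V (i, j') - ∑ i', V (i', j)))
    (b * (∑ j', W (i, j') - ∑ i', W (i', j)))).trans_eq ?_)
  · ring_nf
  · rw [abs_mul, abs_mul, abs_of_nonneg ha, abs_of_nonneg hb]

/-- A convex function on a cube is dominated by one of its values at the vertices. -/
lemma exists_vertex_rowColumnSpread_le (k : ℕ) {n : ℕ} {W : Fin n × Fin n → ℝ}
    (hW : ∀ p, W p ∈ Set.Icc (0 : ℝ) 1) :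
    ∃ V : Fin n × Fin n → ℝ, (∀ p, V p = 0 ∨ V p = 1) ∧
      rowColumnSpread k W ≤ rowColumnSpread k V := by
  have hmem : W ∈ convexHull ℝ (Set.univ.pi fun _ : Fin n × Fin n => ({0, 1} : Set ℝ)) := by
    rw [convexHull_pi]
    intro p _
    simpa only [convexHull_pair, segment_eq_Icc (zero_le_one' ℝ)] using hW p
  obtain ⟨V, hV, hle⟩ :=
    (convexOn_rowColumnSpread k n).exists_ge_of_mem_convexHull (Set.subset_univ _) hmem
  exact ⟨V, fun p => by simpa using hV p (Set.mem_univ p), hle⟩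

/-- The bipartite graph with a prescribed biadjacency relation. -/
def bipartiteGraphOf {n : ℕ} (R : Fin n → Fin n → Prop) : SimpleGraph (Fin n ⊕ Fin n) where
  Adj a b := (∃ i j, R i j ∧ a = Sum.inl i ∧ b = Sum.inr j) ∨
    ∃ i j, R i j ∧ b = Sum.inl i ∧ a = Sum.inr j
  symm := ⟨fun _ _ h => h.symm⟩
  loopless := ⟨by
    rintro a (⟨i, j, -, h, h'⟩ | ⟨i, j, -, h, h'⟩) <;> simp [h] at h'⟩

lemma bipartiteGraphOf_mem {n : ℕ} (R : Fin n → Fin n → Prop) :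
    bipartiteGraphOf R ∈ bipartiteGraphs n := by
  refine ⟨?_, ?_⟩
  · rw [Set.disjoint_left]
    rintro _ ⟨i, rfl⟩ ⟨j, h⟩
    simp at h
  · rintro a b (⟨i, j, -, rfl, rfl⟩ | ⟨i, j, -, rfl, rfl⟩) <;> simp

open scoped Classical in
lemma degree_inl_of_mem_bipartiteGraphs {n : ℕ} {G : SimpleGraph (Fin n ⊕ Fin n)}
    (hG : G ∈ bipartiteGraphs n) (i : Fin n) :
    (G.degree (Sum.inl i) : ℝ) = ∑ j, if G.Adj (Sum.inl i) (Sum.inr j) then (1 : ℝ) else 0 := by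
  have h : ∀ a : Fin n, ¬ G.Adj (Sum.inl i) (Sum.inl a) := fun a hab => by
    simpa using hG.2 hab
  rw [← SimpleGraph.card_neighborFinset_eq_degree, SimpleGraph.neighborFinset_eq_filter,
    Finset.card_filter, Nat.cast_sum, Fintype.sum_sum_type]
  simp [h]

open scoped Classical in
lemma degree_inr_of_mem_bipartiteGraphs {n : ℕ} {G : SimpleGraph (Fin n ⊕ Fin n)}
    (hG : G ∈ bipartiteGraphs n) (j : Fin n) :
    (G.degree (Sum.inr j) : ℝ) = ∑ i, if G.Adj (Sum.inl i) (Sum.inr j) then (1 : ℝ) else 0 := by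
  have h : ∀ a : Fin n, ¬ G.Adj (Sum.inr j) (Sum.inr a) := fun a hab => by
    simpa using hG.2 hab
  rw [← SimpleGraph.card_neighborFinset_eq_degree, SimpleGraph.neighborFinset_eq_filter,
    Finset.card_filter, Nat.cast_sum, Fintype.sum_sum_type]
  simp [h, G.adj_comm (Sum.inr j)]

open scoped Classical in
lemma degreeSpread_eq_rowColumnSpread (k : ℕ) {n : ℕ} {G : SimpleGraph (Fin n ⊕ Fin n)}
    (hG : G ∈ bipartiteGraphs n) :
    degreeSpread k n G = 1 / (n : ℝ) ^ (2 + k) *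
      rowColumnSpread k fun p => if G.Adj (Sum.inl p.1) (Sum.inr p.2) then (1 : ℝ) else 0 := by
  unfold degreeSpread rowColumnSpread
  congr 1
  refine Finset.sum_congr rfl fun i _ => Finset.sum_congr rfl fun j _ => ?_
  rw [← degree_inl_of_mem_bipartiteGraphs hG, ← degree_inr_of_mem_bipartiteGraphs hG]

lemma exists_bipartiteGraph_rowColumnSpread_le (k : ℕ) {n : ℕ} (hn : 0 < n)
    {W : Fin n × Fin n → ℝ} (hW : ∀ p, W p ∈ Set.Icc (0 : ℝ) 1) :
    ∃ G ∈ bipartiteGraphs n, rowColumnSpread k W ≤ (n : ℝ) ^ (2 + k) * degreeSpread k n G := by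
  classical
  obtain ⟨V, hV, hle⟩ := exists_vertex_rowColumnSpread_le k hW
  refine ⟨_, bipartiteGraphOf_mem fun i j => V (i, j) = 1, hle.trans (le_of_eq ?_)⟩
  have hpos : (n : ℝ) ^ (2 + k) ≠ 0 := by positivity
  rw [degreeSpread_eq_rowColumnSpread k (bipartiteGraphOf_mem _), ← mul_assoc,
    mul_one_div_cancel hpos, one_mul]
  congr 1
  funext p
  rcases hV p with h | h <;> simp [bipartiteGraphOf, h]

lemma degreeSpread_le_one (k : ℕ) {n : ℕ} (hn : 0 < n) {G : SimpleGraph (Fin n ⊕ Fin n)}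
    (hG : G ∈ bipartiteGraphs n) : degreeSpread k n G ≤ 1 := by
  classical
  rw [degreeSpread_eq_rowColumnSpread k hG, one_div_mul_eq_div, div_le_one (by positivity)]
  have hsum : ∀ s : Fin n → Prop, 0 ≤ ∑ i, (if s i then (1 : ℝ) else 0) ∧
      ∑ i, (if s i then (1 : ℝ) else 0) ≤ n := fun s =>
    ⟨Finset.sum_nonneg fun i _ => by split_ifs <;> norm_num,
      (Finset.sum_le_sum fun i _ => (by split_ifs <;> norm_num :
        (if s i then (1 : ℝ) else 0) ≤ 1)).trans_eq (by simp)⟩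
  calc _ ≤ ∑ _i : Fin n, ∑ _j : Fin n, (n : ℝ) ^ k := by
        refine Finset.sum_le_sum fun i _ => Finset.sum_le_sum fun j _ => ?_
        refine pow_le_pow_left₀ (abs_nonneg _) (abs_sub_le_iff.2 ⟨?_, ?_⟩) k
        · linarith [(hsum fun j' => G.Adj (Sum.inl i) (Sum.inr j')).2,
            (hsum fun i' => G.Adj (Sum.inl i') (Sum.inr j)).1]
        · linarith [(hsum fun j' => G.Adj (Sum.inl i) (Sum.inr j')).1,
            (hsum fun i' => G.Adj (Sum.inl i') (Sum.inr j)).2]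
    _ = (n : ℝ) ^ (2 + k) := by simp; ring

end Graphs

/-! ### Tangent lines of the power function -/

section Tangent

/-- Multiplying the case `k` by `u` overshoots the next tangent line by exactly `(k + 1) v^k (u -
v)²`. -/
lemma pow_tangent_le {u v : ℝ} (hu : 0 ≤ u) (hv : 0 ≤ v) (k : ℕ) :
    v ^ (k + 1) + (k + 1) * v ^ k * (u - v) ≤ u ^ (k + 1) := by
  induction k with
  | zero => simp
  | succ k ih =>
    have h1 := mul_le_mul_of_nonneg_left ih hu
    have h2 : 0 ≤ (k + 1) * v ^ k * (u - v) ^ 2 := by positivity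
    push_cast
    linear_combination h1 + h2

/-- The graph of `|·|^k` lies above its tangent lines. -/
lemma abs_pow_tangent_le (a b : ℝ) {k : ℕ} (hk : 2 ≤ k) :
    |b| ^ k + k * |b| ^ (k - 2) * b * (a - b) ≤ |a| ^ k := by
  obtain ⟨m, rfl⟩ := Nat.exists_eq_add_of_le' hk
  have h := pow_tangent_le (abs_nonneg a) (abs_nonneg b) (m + 1)
  have h1 : b * a ≤ |b| * |a| := by rw [← abs_mul]; exact le_abs_self _
  have h2 : b * b = |b| * |b| := (abs_mul_abs_self b).symm
  have h3 : 0 ≤ ((m : ℝ) + 2) * |b| ^ m := by positivity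
  have h4 := mul_le_mul_of_nonneg_left h1 h3
  simp only [Nat.add_sub_cancel]
  push_cast at h ⊢
  linear_combination h + h4 - ((m : ℝ) + 2) * |b| ^ m * h2

end Tangent

/-! ### Random matrices sampled from a density on a product space -/

section Sampling

variable {α : Type*} [MeasurableSpace α]

lemma integrable_of_abs_le {β : Type*} [MeasurableSpace β] {P : Measure β} [IsFiniteMeasure P]
    {g : β → ℝ} (hg : Measurable g) {C : ℝ} (hC : ∀ b, |g b| ≤ C) : Integrable g P :=
  Integrable.of_bound hg.aestronglyMeasurable C (Filter.Eventually.of_forall hC)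

/-- The law of `n` independent points sampled from `μ` and `n` independent points sampled
from `ν`. -/
noncomputable def sampleLaw (μ ν : Measure α) (n : ℕ) : Measure (Fin n ⊕ Fin n → α) :=
  Measure.pi (Sum.elim (fun _ => μ) (fun _ => ν))

variable {μ ν : Measure α} [IsProbabilityMeasure μ] [IsProbabilityMeasure ν] {n : ℕ}

instance sumElim_isProbabilityMeasure (a : Fin n ⊕ Fin n) :
    IsProbabilityMeasure (Sum.elim (fun _ : Fin n => μ) (fun _ : Fin n => ν) a) := by
  cases a <;> simpa

instance sampleLaw_isProbabilityMeasure : IsProbabilityMeasure (sampleLaw μ ν n) := by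
  unfold sampleLaw; infer_instance

lemma iIndepFun_sampleLaw :
    iIndepFun (fun (a : Fin n ⊕ Fin n) (ω : Fin n ⊕ Fin n → α) => ω a) (sampleLaw μ ν n) :=
  iIndepFun_pi (X := fun _ x => x) fun _ => aemeasurable_id

lemma map_eval_sampleLaw (a : Fin n ⊕ Fin n) :
    (sampleLaw μ ν n).map (fun ω => ω a) = Sum.elim (fun _ => μ) (fun _ => ν) a :=
  (measurePreserving_eval _ a).map_eq

lemma map_eval_pair_sampleLaw {a b : Fin n ⊕ Fin n} (hab : a ≠ b) :
    (sampleLaw μ ν n).map (fun ω => (ω a, ω b)) =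
      Measure.prod (Sum.elim (fun _ => μ) (fun _ => ν) a)
        (Sum.elim (fun _ => μ) (fun _ => ν) b) := by
  rw [(indepFun_iff_map_prod_eq_prod_map_map (Measurable.aemeasurable (by fun_prop))
      (Measurable.aemeasurable (by fun_prop))).1
    (iIndepFun_sampleLaw.indepFun hab), map_eval_sampleLaw, map_eval_sampleLaw]

/-- The nesting isolates `c`: once it is frozen, what remains is an integral over the law of the
pair `(a, b)`. -/
lemma map_eval_triple_sampleLaw {a b c : Fin n ⊕ Fin n} (hab : a ≠ b) (hac : a ≠ c) (hbc : b ≠ c) :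
    (sampleLaw μ ν n).map (fun ω => ((ω a, ω b), ω c)) =
      Measure.prod (Measure.prod (Sum.elim (fun _ => μ) (fun _ => ν) a)
        (Sum.elim (fun _ => μ) (fun _ => ν) b)) (Sum.elim (fun _ => μ) (fun _ => ν) c) := by
  rw [(indepFun_iff_map_prod_eq_prod_map_map (Measurable.aemeasurable (by fun_prop))
      (Measurable.aemeasurable (by fun_prop))).1
    (iIndepFun_sampleLaw.indepFun_prodMk (by fun_prop) a b c hac hbc), map_eval_sampleLaw,
    map_eval_pair_sampleLaw hab]

lemma integral_pair_sampleLaw (i j : Fin n) {g : α × α → ℝ} (hg : Measurable g) :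
    ∫ ω, g (ω (Sum.inl i), ω (Sum.inr j)) ∂(sampleLaw μ ν n) = ∫ p, g p ∂(μ.prod ν) := by
  have h := map_eval_pair_sampleLaw (μ := μ) (ν := ν) (a := Sum.inl i) (b := Sum.inr j) (by simp)
  simp only [Sum.elim_inl, Sum.elim_inr] at h
  rw [← h, integral_map (by fun_prop) hg.aestronglyMeasurable]

/-- If `h` is orthogonal to all bounded functions of the first coordinate, then a sampled copy of
`h` is orthogonal to bounded functions of its row point and of an independent column point. -/
lemma integral_row_cross {h : α × α → ℝ} (hh : Measurable h) {C : ℝ} (hC : ∀ p, |h p| ≤ C)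
    (horth : ∀ g : α → ℝ, Measurable g → (∃ D, ∀ s, |g s| ≤ D) →
      ∫ p, g p.1 * h p ∂(μ.prod ν) = 0)
    {g : α × α → ℝ} (hg : Measurable g) {D : ℝ} (hD : ∀ p, |g p| ≤ D)
    (i : Fin n) {j j' : Fin n} (hj : j' ≠ j) :
    ∫ ω, g (ω (Sum.inl i), ω (Sum.inr j)) * h (ω (Sum.inl i), ω (Sum.inr j'))
      ∂(sampleLaw μ ν n) = 0 := by
  have hmap := map_eval_triple_sampleLaw (μ := μ) (ν := ν) (a := Sum.inl i) (b := Sum.inr j')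
    (c := Sum.inr j) (by simp) (by simp) (by simpa using hj)
  simp only [Sum.elim_inl, Sum.elim_inr] at hmap
  have hmeas : Measurable fun q : (α × α) × α => g (q.1.1, q.2) * h q.1 := by fun_prop
  calc _ = ∫ q, g (q.1.1, q.2) * h q.1 ∂((μ.prod ν).prod ν) := by
        rw [← hmap, integral_map (by fun_prop) hmeas.aestronglyMeasurable]
    -- With the column point `t` frozen, `g (·, t)` is a bounded function of the row point alone, so
    -- `horth` applies.
    _ = ∫ t, ∫ p, g (p.1, t) * h p ∂(μ.prod ν) ∂ν := by
        refine integral_prod_symm _ (integrable_of_abs_le hmeas (C := D * C) fun q => ?_)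
        rw [abs_mul]
        exact mul_le_mul (hD _) (hC _) (abs_nonneg _) ((abs_nonneg _).trans (hD (q.1.1, q.2)))
    _ = 0 := by
        simp_rw [fun t => horth (fun s => g (s, t)) (by fun_prop) ⟨D, fun s => hD _⟩]
        simp

lemma integral_column_cross {h : α × α → ℝ} (hh : Measurable h) {C : ℝ} (hC : ∀ p, |h p| ≤ C)
    (horth : ∀ g : α → ℝ, Measurable g → (∃ D, ∀ s, |g s| ≤ D) →
      ∫ p, g p.2 * h p ∂(μ.prod ν) = 0)
    {g : α × α → ℝ} (hg : Measurable g) {D : ℝ} (hD : ∀ p, |g p| ≤ D)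
    (j : Fin n) {i i' : Fin n} (hi : i' ≠ i) :
    ∫ ω, g (ω (Sum.inl i), ω (Sum.inr j)) * h (ω (Sum.inl i'), ω (Sum.inr j))
      ∂(sampleLaw μ ν n) = 0 := by
  have hmap := map_eval_triple_sampleLaw (μ := μ) (ν := ν) (a := Sum.inl i') (b := Sum.inr j)
    (c := Sum.inl i) (by simp) (by simpa using hi) (by simp)
  simp only [Sum.elim_inl, Sum.elim_inr] at hmap
  have hmeas : Measurable fun q : (α × α) × α => g (q.2, q.1.2) * h q.1 := by fun_prop
  calc _ = ∫ q, g (q.2, q.1.2) * h q.1 ∂((μ.prod ν).prod μ) := by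
        rw [← hmap, integral_map (by fun_prop) hmeas.aestronglyMeasurable]
    _ = ∫ s, ∫ p, g (s, p.2) * h p ∂(μ.prod ν) ∂μ := by
        refine integral_prod_symm _ (integrable_of_abs_le hmeas (C := D * C) fun q => ?_)
        rw [abs_mul]
        exact mul_le_mul (hD _) (hC _) (abs_nonneg _) ((abs_nonneg _).trans (hD (q.2, q.1.2)))
    _ = 0 := by
        simp_rw [fun s => horth (fun t => g (s, t)) (by fun_prop) ⟨D, fun t => hD _⟩]
        simp

variable {x y : α → ℝ} {f : α × α → ℝ}

/-- The matrix `f(s_i, t_j)` evaluated at sampled points. -/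
def sampledMatrix (f : α × α → ℝ) (ω : Fin n ⊕ Fin n → α) (p : Fin n × Fin n) : ℝ :=
  f (ω (Sum.inl p.1), ω (Sum.inr p.2))

lemma abs_sub_le_one_of_mem_Icc {a b : ℝ} (ha : a ∈ Set.Icc (0 : ℝ) 1)
    (hb : b ∈ Set.Icc (0 : ℝ) 1) : |a - b| ≤ 1 :=
  abs_sub_le_iff.2 ⟨by linarith [ha.2, hb.1], by linarith [hb.2, ha.1]⟩

lemma integrable_row_sub_column (hf : Measurable f) (hf1 : ∀ p, f p ∈ Set.Icc (0 : ℝ) 1) (k : ℕ)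
    (i j : Fin n) :
    Integrable (fun ω : Fin n ⊕ Fin n → α =>
      |∑ j', sampledMatrix f ω (i, j') - ∑ i', sampledMatrix f ω (i', j)| ^ k)
      (sampleLaw μ ν n) := by
  have hWm : ∀ p, Measurable fun ω : Fin n ⊕ Fin n → α => sampledMatrix f ω p := fun p => by
    unfold sampledMatrix; fun_prop
  refine integrable_of_abs_le (by fun_prop) (C := (n : ℝ) ^ k) fun ω => ?_
  rw [abs_pow, abs_abs, ← Finset.sum_sub_distrib]
  refine pow_le_pow_left₀ (abs_nonneg _) ((Finset.abs_sum_le_sum_abs _ _).trans ?_) k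
  exact (Finset.sum_le_sum fun l _ =>
    abs_sub_le_one_of_mem_Icc (hf1 _) (hf1 _)).trans_eq (by simp)

/-- The entry `W (i, j)` lies in both sums and cancels, leaving `n - 1` entries on each side. This
matters because that entry depends on both sampled points and is not centred given them. -/
lemma row_sub_column_eq (W : Fin n × Fin n → ℝ) (c d : ℝ) (i j : Fin n) :
    ∑ j', W (i, j') - ∑ i', W (i', j) - ((n : ℝ) - 1) * (c - d) =
      ∑ j' ∈ Finset.univ.erase j, (W (i, j') - c) -
        ∑ i' ∈ Finset.univ.erase i, (W (i', j) - d) := by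
  have hn : 1 ≤ n := Fin.pos i
  rw [Finset.sum_sub_distrib, Finset.sum_sub_distrib, ← Finset.add_sum_erase _ _ (Finset.mem_univ j),
    ← Finset.add_sum_erase (a := i) _ (fun i' => W (i', j)) (Finset.mem_univ i)]
  simp only [Finset.sum_const, Finset.card_erase_of_mem (Finset.mem_univ _), Finset.card_univ,
    Fintype.card_fin, nsmul_eq_mul, Nat.cast_sub hn]
  push_cast
  ring

/-- Jensen's inequality conditionally on `s_i` and `t_j`, carried out through the tangent line of
`|·|^k` at the conditional mean `b`, whose slope is `G`. The linear term has mean zero by the cross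
lemmas. -/
lemma integral_abs_row_sub_column_ge (hx : Measurable x) (hy : Measurable y) (hf : Measurable f)
    (hx1 : ∀ s, x s ∈ Set.Icc (0 : ℝ) 1) (hy1 : ∀ t, y t ∈ Set.Icc (0 : ℝ) 1)
    (hf1 : ∀ p, f p ∈ Set.Icc (0 : ℝ) 1)
    (hfx : ∀ g : α → ℝ, Measurable g → (∃ D, ∀ s, |g s| ≤ D) →
      ∫ p, g p.1 * (f p - x p.1) ∂(μ.prod ν) = 0)
    (hfy : ∀ g : α → ℝ, Measurable g → (∃ D, ∀ s, |g s| ≤ D) →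
      ∫ p, g p.2 * (f p - y p.2) ∂(μ.prod ν) = 0)
    {k : ℕ} (hk : 2 ≤ k) (i j : Fin n) :
    ((n : ℝ) - 1) ^ k * ∫ p, |x p.1 - y p.2| ^ k ∂(μ.prod ν) ≤
      ∫ ω, |∑ j', sampledMatrix f ω (i, j') - ∑ i', sampledMatrix f ω (i', j)| ^ k
        ∂(sampleLaw μ ν n) := by
  have hn : 1 ≤ n := Fin.pos i
  have hn0 : (0 : ℝ) ≤ (n : ℝ) - 1 := by
    have : (1 : ℝ) ≤ n := by exact_mod_cast hn
    linarith
  set b : α × α → ℝ := fun p => ((n : ℝ) - 1) * (x p.1 - y p.2) with hb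
  set G : α × α → ℝ := fun p => k * |b p| ^ (k - 2) * b p with hG
  have hbm : Measurable b := by fun_prop
  have hGm : Measurable G := by fun_prop
  have hb1 : ∀ p, |b p| ≤ (n : ℝ) - 1 := fun p => by
    rw [hb, abs_mul, abs_of_nonneg hn0]
    exact mul_le_of_le_one_right hn0 (abs_sub_le_one_of_mem_Icc (hx1 _) (hy1 _))
  have hG1 : ∀ p, |G p| ≤ k * ((n : ℝ) - 1) ^ (k - 2) * ((n : ℝ) - 1) := fun p => by
    rw [hG, abs_mul, abs_mul, abs_pow, abs_abs, Nat.abs_cast]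
    gcongr <;> exact hb1 p
  set D := (k : ℝ) * ((n : ℝ) - 1) ^ (k - 2) * ((n : ℝ) - 1) with hD
  have hfX : ∀ p, |f p - x p.1| ≤ 1 := fun p => abs_sub_le_one_of_mem_Icc (hf1 p) (hx1 _)
  have hfY : ∀ p, |f p - y p.2| ≤ 1 := fun p => abs_sub_le_one_of_mem_Icc (hf1 p) (hy1 _)
  have hprod : ∀ {u v : ℝ}, |u| ≤ D → |v| ≤ 1 → |u * v| ≤ D := fun {u v} hu hv => by
    rw [abs_mul]; exact (mul_le_of_le_one_right (abs_nonneg u) hv).trans hu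
  have hIrow : ∀ j', Integrable (fun ω : Fin n ⊕ Fin n → α => G (ω (Sum.inl i), ω (Sum.inr j)) *
      (f (ω (Sum.inl i), ω (Sum.inr j')) - x (ω (Sum.inl i)))) (sampleLaw μ ν n) := fun j' =>
    integrable_of_abs_le (by fun_prop) fun ω =>
      hprod (hG1 _) (hfX (ω (Sum.inl i), ω (Sum.inr j')))
  have hIcol : ∀ i', Integrable (fun ω : Fin n ⊕ Fin n → α => G (ω (Sum.inl i), ω (Sum.inr j)) *
      (f (ω (Sum.inl i'), ω (Sum.inr j)) - y (ω (Sum.inr j)))) (sampleLaw μ ν n) := fun i' =>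
    integrable_of_abs_le (by fun_prop) fun ω =>
      hprod (hG1 _) (hfY (ω (Sum.inl i'), ω (Sum.inr j)))
  have hIb : Integrable (fun ω : Fin n ⊕ Fin n → α => |b (ω (Sum.inl i), ω (Sum.inr j))| ^ k)
      (sampleLaw μ ν n) :=
    integrable_of_abs_le (by fun_prop) (C := ((n : ℝ) - 1) ^ k) fun ω => by
      rw [abs_pow, abs_abs]; exact pow_le_pow_left₀ (abs_nonneg _) (hb1 _) k
  have hIR := integrable_finsetSum (Finset.univ.erase j) fun j' _ => hIrow j'
  have hIC := integrable_finsetSum (Finset.univ.erase i) fun i' _ => hIcol i'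
  have hIRC := hIR.sub hIC
  simp only [Pi.sub_def] at hIRC
  have hrow0 := fun j' (hj : j' ∈ Finset.univ.erase j) => integral_row_cross (n := n) (μ := μ) (ν := ν)
    (h := fun p => f p - x p.1) (by fun_prop) hfX hfx hGm hG1 i (Finset.ne_of_mem_erase hj)
  have hcol0 := fun i' (hi : i' ∈ Finset.univ.erase i) => integral_column_cross (n := n) (μ := μ) (ν := ν)
    (h := fun p => f p - y p.2) (by fun_prop) hfY hfy hGm hG1 j (Finset.ne_of_mem_erase hi)
  calc ((n : ℝ) - 1) ^ k * ∫ p, |x p.1 - y p.2| ^ k ∂(μ.prod ν)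
      = ∫ ω, |b (ω (Sum.inl i), ω (Sum.inr j))| ^ k ∂(sampleLaw μ ν n) := by
        rw [integral_pair_sampleLaw i j (g := fun p => |b p| ^ k) (by fun_prop),
          ← integral_const_mul]
        simp only [hb, abs_mul, mul_pow, abs_of_nonneg hn0]
    _ = ∫ ω, (|b (ω (Sum.inl i), ω (Sum.inr j))| ^ k +
          (∑ j' ∈ Finset.univ.erase j, G (ω (Sum.inl i), ω (Sum.inr j)) *
            (f (ω (Sum.inl i), ω (Sum.inr j')) - x (ω (Sum.inl i))) -
          ∑ i' ∈ Finset.univ.erase i, G (ω (Sum.inl i), ω (Sum.inr j)) *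
            (f (ω (Sum.inl i'), ω (Sum.inr j)) - y (ω (Sum.inr j))))) ∂(sampleLaw μ ν n) := by
        rw [integral_add hIb hIRC, integral_sub hIR hIC,
          integral_finsetSum _ fun j' _ => hIrow j', integral_finsetSum _ fun i' _ => hIcol i',
          Finset.sum_eq_zero hrow0, Finset.sum_eq_zero hcol0, sub_zero, add_zero]
    _ ≤ _ := by
        refine integral_mono (hIb.add hIRC)
          (integrable_row_sub_column hf hf1 k i j) fun ω => ?_
        refine le_trans (le_of_eq ?_) (abs_pow_tangent_le _ (b (ω (Sum.inl i), ω (Sum.inr j))) hk)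
        rw [← Finset.mul_sum, ← Finset.mul_sum, ← mul_sub]
        exact congrArg (fun t => _ + _ * t) (row_sub_column_eq (sampledMatrix f ω)
          (x (ω (Sum.inl i))) (y (ω (Sum.inr j))) i j).symm

/-- An upper bound on `degreeSpread` for graphs with `n + n` vertices bounds the moment of a
`[0, 1]`-valued density on a product space through the matrices sampled from that density. -/
lemma moment_le_of_degreeSpread_le (hx : Measurable x) (hy : Measurable y) (hf : Measurable f)
    (hx1 : ∀ s, x s ∈ Set.Icc (0 : ℝ) 1) (hy1 : ∀ t, y t ∈ Set.Icc (0 : ℝ) 1)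
    (hf1 : ∀ p, f p ∈ Set.Icc (0 : ℝ) 1)
    (hfx : ∀ g : α → ℝ, Measurable g → (∃ D, ∀ s, |g s| ≤ D) →
      ∫ p, g p.1 * (f p - x p.1) ∂(μ.prod ν) = 0)
    (hfy : ∀ g : α → ℝ, Measurable g → (∃ D, ∀ s, |g s| ≤ D) →
      ∫ p, g p.2 * (f p - y p.2) ∂(μ.prod ν) = 0)
    {k : ℕ} (hk : 2 ≤ k) (hn : 0 < n) {S : ℝ}
    (hS : ∀ G ∈ bipartiteGraphs n, degreeSpread k n G ≤ S) :
    (1 - 1 / (n : ℝ)) ^ k * ∫ p, |x p.1 - y p.2| ^ k ∂(μ.prod ν) ≤ S := by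
  have hW1 : ∀ (ω : Fin n ⊕ Fin n → α) p, sampledMatrix f ω p ∈ Set.Icc (0 : ℝ) 1 := fun ω p => hf1 _
  have hI := fun i j => integrable_row_sub_column (μ := μ) (ν := ν) (n := n) hf hf1 k i j
  have hIs : Integrable (fun ω : Fin n ⊕ Fin n → α => rowColumnSpread k (sampledMatrix f ω))
      (sampleLaw μ ν n) :=
    integrable_finsetSum _ fun i _ => integrable_finsetSum _ fun j _ => hI i j
  have hnpos : (0 : ℝ) < n := by exact_mod_cast hn
  set M := ∫ p, |x p.1 - y p.2| ^ k ∂(μ.prod ν)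
  have key : (n : ℝ) ^ 2 * (((n : ℝ) - 1) ^ k * M) ≤ (n : ℝ) ^ (2 + k) * S := by
    calc (n : ℝ) ^ 2 * (((n : ℝ) - 1) ^ k * M)
        = ∑ _i : Fin n, ∑ _j : Fin n, ((n : ℝ) - 1) ^ k * M := by simp; ring
      _ ≤ ∑ i : Fin n, ∑ j : Fin n, ∫ ω, |∑ j', sampledMatrix f ω (i, j') -
            ∑ i', sampledMatrix f ω (i', j)| ^ k ∂(sampleLaw μ ν n) :=
          Finset.sum_le_sum fun i _ => Finset.sum_le_sum fun j _ =>
            integral_abs_row_sub_column_ge hx hy hf hx1 hy1 hf1 hfx hfy hk i j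
      _ = ∫ ω, rowColumnSpread k (sampledMatrix f ω) ∂(sampleLaw μ ν n) := by
          unfold rowColumnSpread
          rw [integral_finsetSum _ fun i _ => integrable_finsetSum _ fun j _ => hI i j]
          exact Finset.sum_congr rfl fun i _ => (integral_finsetSum _ fun j _ => hI i j).symm
      _ ≤ ∫ _ω, (n : ℝ) ^ (2 + k) * S ∂(sampleLaw μ ν n) := by
          refine integral_mono hIs (integrable_const _) fun ω => ?_
          obtain ⟨G, hG, hle⟩ := exists_bipartiteGraph_rowColumnSpread_le k hn (hW1 ω)
          exact hle.trans (mul_le_mul_of_nonneg_left (hS G hG) (by positivity))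
      _ = (n : ℝ) ^ (2 + k) * S := by simp
  -- The factor `n²` counts the pairs `(i, j)`; dividing it out leaves `((n - 1) / n)^k`.
  have hfrac : (1 : ℝ) - 1 / n = (n - 1) / n := by field_simp
  rw [hfrac, div_pow, div_mul_eq_mul_div, div_le_iff₀ (by positivity)]
  refine le_of_mul_le_mul_left ?_ (by positivity : (0 : ℝ) < (n : ℝ) ^ 2)
  calc _ ≤ _ := key
    _ = _ := by ring

end Sampling

/-! ### From coherent pairs to densities on a product space -/

section Coherent

variable {Ω : Type*} {m mΩ : MeasurableSpace Ω} {P : Measure Ω} [IsProbabilityMeasure P]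

lemma integral_mul_condExp_of_bounded (hm : m ≤ mΩ) {g F : Ω → ℝ} (hg : Measurable[m] g) {D : ℝ}
    (hD : ∀ ω, |g ω| ≤ D) (hF : Integrable F P) :
    ∫ ω, g ω * (P[F | m]) ω ∂P = ∫ ω, g ω * F ω ∂P := by
  have hgF : Integrable (g * F) P :=
    hF.bdd_mul (hg.mono hm le_rfl).aestronglyMeasurable (Filter.Eventually.of_forall hD)
  have h := condExp_mul_of_stronglyMeasurable_left hg.stronglyMeasurable hgF hF
  calc _ = ∫ ω, (P[g * F | m]) ω ∂P := integral_congr_ae h.symm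
    _ = _ := integral_condExp hm

lemma condExp_indicator_one_mem_Icc (hm : m ≤ mΩ) {A : Set Ω} (hA : MeasurableSet[mΩ] A) :
    ∀ᵐ ω ∂P, (P[A.indicator (fun _ => (1 : ℝ)) | m]) ω ∈ Set.Icc (0 : ℝ) 1 := by
  have hint : Integrable (A.indicator fun _ => (1 : ℝ)) P := (integrable_const _).indicator hA
  have h0 : 0 ≤ᵐ[P] P[A.indicator (fun _ => (1 : ℝ)) | m] :=
    condExp_nonneg (Filter.Eventually.of_forall fun ω =>
      Set.indicator_nonneg (fun _ _ => zero_le_one) ω)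
  have h1 : P[A.indicator (fun _ => (1 : ℝ)) | m] ≤ᵐ[P] P[fun _ => (1 : ℝ) | m] :=
    condExp_mono hint (integrable_const _) (Filter.Eventually.of_forall fun ω =>
      Set.indicator_le_self' (fun _ _ => zero_le_one) ω)
  rw [condExp_const hm] at h1
  filter_upwards [h0, h1] with ω h h' using ⟨h, h'⟩

/-- Truncation of a real number to `[0, 1]`. -/
noncomputable def unitClamp (t : ℝ) : ℝ := max 0 (min 1 t)

lemma measurable_unitClamp : Measurable unitClamp := by unfold unitClamp; fun_prop

lemma unitClamp_mem_Icc (t : ℝ) : unitClamp t ∈ Set.Icc (0 : ℝ) 1 :=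
  ⟨le_max_left _ _, max_le zero_le_one (min_le_left _ _)⟩

lemma unitClamp_of_mem_Icc {t : ℝ} (ht : t ∈ Set.Icc (0 : ℝ) 1) : unitClamp t = t := by
  rw [unitClamp, min_eq_right ht.2, max_eq_right ht.1]

/-- A version `X` of `P[F | m]` has the same correlations as `F` with bounded functions of `X`. -/
lemma integral_comp_mul_self_of_ae_eq_condExp (hm : m ≤ mΩ) {F X : Ω → ℝ}
    (hF : Integrable F P) (hX : X =ᵐ[P] P[F | m]) {g : ℝ → ℝ} (hg : Measurable g) {D : ℝ}
    (hD : ∀ s, |g s| ≤ D) : ∫ ω, g (X ω) * X ω ∂P = ∫ ω, g (X ω) * F ω ∂P := by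
  calc _ = ∫ ω, g ((P[F | m]) ω) * (P[F | m]) ω ∂P :=
        integral_congr_ae (hX.mono fun ω h => by simp only [h])
    _ = ∫ ω, g ((P[F | m]) ω) * F ω ∂P :=
        integral_mul_condExp_of_bounded hm (hg.comp stronglyMeasurable_condExp.measurable)
          (fun ω => hD _) hF
    _ = _ := integral_congr_ae (hX.mono fun ω h => by simp only [h])

lemma integral_comp_eq_integral_prod {X Y : Ω → ℝ} (hX : Measurable X)
    (hY : Measurable Y) (hXY : IndepFun X Y P) {φ : ℝ × ℝ → ℝ} (hφ : Measurable φ) :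
    ∫ p, φ p ∂((P.map X).prod (P.map Y)) = ∫ ω, φ (X ω, Y ω) ∂P := by
  rw [← (indepFun_iff_map_prod_eq_prod_map_map hX.aemeasurable hY.aemeasurable).1 hXY,
    integral_map (by fun_prop) hφ.aestronglyMeasurable]

/-- A calibrated forecast `X` of the event `A`: it takes values in `[0, 1]` and has the same
correlations as the indicator of `A` with all bounded functions of `X`. -/
def IsCalibrated {Ω : Type*} [MeasurableSpace Ω] (P : Measure Ω) (A : Set Ω) (X : Ω → ℝ) : Prop :=
  (∀ᵐ ω ∂P, X ω ∈ Set.Icc (0 : ℝ) 1) ∧ ∀ g : ℝ → ℝ, Measurable g → ∀ D : ℝ, (∀ s, |g s| ≤ D) →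
    ∫ ω, g (X ω) * X ω ∂P = ∫ ω, g (X ω) * A.indicator (fun _ => (1 : ℝ)) ω ∂P

lemma isCalibrated_of_ae_eq_condExp (hm : m ≤ mΩ) {A : Set Ω} (hA : MeasurableSet[mΩ] A)
    {X : Ω → ℝ} (hX : X =ᵐ[P] P[A.indicator (fun _ => (1 : ℝ)) | m]) : IsCalibrated P A X := by
  refine ⟨?_, fun g hg D hD => integral_comp_mul_self_of_ae_eq_condExp hm
    ((integrable_const _).indicator hA) hX hg hD⟩
  filter_upwards [hX, condExp_indicator_one_mem_Icc (P := P) hm hA] with ω h1 h2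
  rwa [h1]

lemma IsCalibrated.moment_le {A : Set Ω} (hA : MeasurableSet A) {X Y : Ω → ℝ} (hX : Measurable X)
    (hY : Measurable Y) (hXA : IsCalibrated P A X) (hYA : IsCalibrated P A Y)
    (hXY : IndepFun X Y P) {k : ℕ} (hk : 2 ≤ k) {S : ℝ}
    (hS : ∀ n : ℕ, 0 < n → ∀ G ∈ bipartiteGraphs n, degreeSpread k n G ≤ S) :
    ∫ ω, |X ω - Y ω| ^ k ∂P ≤ S := by
  obtain ⟨hXI, hXA⟩ := hXA
  obtain ⟨hYI, hYA⟩ := hYA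
  set F : Ω → ℝ := A.indicator fun _ => (1 : ℝ)
  have hF : Integrable F P := (integrable_const _).indicator hA
  set Z : Ω → ℝ × ℝ := fun ω => (X ω, Y ω)
  have hZ : Measurable Z := hX.prodMk hY
  have h𝓩 : MeasurableSpace.comap Z inferInstance ≤ mΩ := hZ.comap_le
  -- Doob–Dynkin: `P(A | X, Y)` is a measurable function `r` of `(X, Y)`. Clamping it, and likewise
  -- `X` and `Y`, turns almost sure bounds into the pointwise ones needed for sampling, without
  -- changing the integrals.
  obtain ⟨r, hr, hrZ⟩ := Measurable.exists_eq_measurable_comp (f := Z) (g := P[F | MeasurableSpace.comap Z inferInstance])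
    stronglyMeasurable_condExp.measurable
  have hrI : ∀ᵐ ω ∂P, r (Z ω) ∈ Set.Icc (0 : ℝ) 1 := by
    filter_upwards [condExp_indicator_one_mem_Icc (P := P) h𝓩 hA] with ω h1
    have h2 : (P[F | MeasurableSpace.comap Z inferInstance]) ω = r (Z ω) := congrFun hrZ ω
    rwa [← h2]
  set f : ℝ × ℝ → ℝ := fun p => unitClamp (r p)
  have hc := measurable_unitClamp
  have hf : Measurable f := hc.comp hr
  have hμ : IsProbabilityMeasure (P.map X) := Measure.isProbabilityMeasure_map hX.aemeasurable
  have hν : IsProbabilityMeasure (P.map Y) := Measure.isProbabilityMeasure_map hY.aemeasurable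
  have hint : ∀ (V : Ω → ℝ), Measurable V → (∀ᵐ ω ∂P, V ω ∈ Set.Icc (0 : ℝ) 1) →
      ∀ U : Ω → ℝ, Measurable U → ∀ D, (∀ ω, |U ω| ≤ D) → Integrable (fun ω => U ω * V ω) P :=
    fun V hV hVI U hU D hD =>
      (Integrable.of_bound hV.aestronglyMeasurable 1 (hVI.mono fun ω h => by
        rw [Real.norm_eq_abs, abs_of_nonneg h.1]; exact h.2)).bdd_mul hU.aestronglyMeasurable
        (Filter.Eventually.of_forall hD)
  -- Applied to `V = X` and `V = Y`: a test function of `V` is measurable for `σ(X, Y)`, so it sees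
  -- `P(A | X, Y)` and the indicator of `A` alike, and calibration replaces the latter by `V`.
  have hcross : ∀ V : Ω → ℝ, Measurable[MeasurableSpace.comap Z inferInstance] V →
      (∀ᵐ ω ∂P, V ω ∈ Set.Icc (0 : ℝ) 1) → ∀ g : ℝ → ℝ, Measurable g → ∀ D : ℝ,
      (∀ s, |g s| ≤ D) → ∫ ω, g (V ω) * V ω ∂P = ∫ ω, g (V ω) * F ω ∂P →
      ∫ ω, g (V ω) * (f (Z ω) - unitClamp (V ω)) ∂P = 0 := by
    intro V hV hVI g hg D hD hVF
    have hVm : Measurable V := hV.mono h𝓩 le_rfl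
    calc _ = ∫ ω, (g (V ω) * r (Z ω) - g (V ω) * V ω) ∂P := by
          refine integral_congr_ae ?_
          filter_upwards [hrI, hVI] with ω h1 h2
          simp only [f, unitClamp_of_mem_Icc h2]
          rw [unitClamp_of_mem_Icc h1, mul_sub]
      _ = ∫ ω, g (V ω) * r (Z ω) ∂P - ∫ ω, g (V ω) * V ω ∂P :=
          integral_sub (hint _ (hr.comp hZ) hrI _ (hg.comp hVm) D fun ω => hD _)
            (hint _ hVm hVI _ (hg.comp hVm) D fun ω => hD _)
      _ = ∫ ω, g (V ω) * (P[F | MeasurableSpace.comap Z inferInstance]) ω ∂P -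
            ∫ ω, g (V ω) * V ω ∂P := by rw [hrZ]; rfl
      _ = 0 := by
          rw [integral_mul_condExp_of_bounded h𝓩 (g := fun ω => g (V ω)) (hg.comp hV) (fun ω => hD _) hF, hVF, sub_self]
  have hfx : ∀ g : ℝ → ℝ, Measurable g → (∃ D, ∀ s, |g s| ≤ D) →
      ∫ p, g p.1 * (f p - unitClamp p.1) ∂((P.map X).prod (P.map Y)) = 0 := by
    rintro g hg ⟨D, hD⟩
    rw [integral_comp_eq_integral_prod hX hY hXY (φ := fun p => g p.1 * (f p - unitClamp p.1))
      (by fun_prop)]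
    exact hcross X (measurable_fst.comp (comap_measurable Z)) hXI g hg D hD (hXA g hg D hD)
  have hfy : ∀ g : ℝ → ℝ, Measurable g → (∃ D, ∀ s, |g s| ≤ D) →
      ∫ p, g p.2 * (f p - unitClamp p.2) ∂((P.map X).prod (P.map Y)) = 0 := by
    rintro g hg ⟨D, hD⟩
    rw [integral_comp_eq_integral_prod hX hY hXY (φ := fun p => g p.2 * (f p - unitClamp p.2))
      (by fun_prop)]
    exact hcross Y (measurable_snd.comp (comap_measurable Z)) hYI g hg D hD (hYA g hg D hD)
  have hM : ∫ p, |unitClamp p.1 - unitClamp p.2| ^ k ∂((P.map X).prod (P.map Y)) =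
      ∫ ω, |X ω - Y ω| ^ k ∂P := by
    rw [integral_comp_eq_integral_prod hX hY hXY
      (φ := fun p => |unitClamp p.1 - unitClamp p.2| ^ k) (by fun_prop)]
    refine integral_congr_ae ?_
    filter_upwards [hXI, hYI] with ω h1 h2
    simp only [unitClamp_of_mem_Icc h1, unitClamp_of_mem_Icc h2]
  rw [← hM]
  have hlim : Filter.Tendsto (fun n : ℕ => (1 - 1 / (n : ℝ)) ^ k *
      ∫ p, |unitClamp p.1 - unitClamp p.2| ^ k ∂((P.map X).prod (P.map Y))) Filter.atTop
      (nhds ((1 - 0) ^ k *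
        ∫ p, |unitClamp p.1 - unitClamp p.2| ^ k ∂((P.map X).prod (P.map Y)))) :=
    ((tendsto_const_nhds.sub tendsto_one_div_atTop_nhds_zero_nat).pow k).mul_const _
  rw [sub_zero, one_pow, one_mul] at hlim
  refine le_of_tendsto hlim ((Filter.eventually_gt_atTop 0).mono fun n hn => ?_)
  exact moment_le_of_degreeSpread_le hc hc hf unitClamp_mem_Icc unitClamp_mem_Icc
    (fun p => unitClamp_mem_Icc _) hfx hfy hk hn (hS n hn)

/-- Moments of independent coherent pairs are bounded by any bound on `degreeSpread`. -/
lemma IsCoherent.moment_le {X Y : Ω → ℝ} (h : IsCoherent P X Y) (hXY : IndepFun X Y P)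
    {k : ℕ} (hk : 2 ≤ k) {S : ℝ}
    (hS : ∀ n : ℕ, 0 < n → ∀ G ∈ bipartiteGraphs n, degreeSpread k n G ≤ S) :
    ∫ ω, |X ω - Y ω| ^ k ∂P ≤ S := by
  obtain ⟨hX, hY, A, 𝓖, 𝓗, hA, h𝓖, h𝓗, hXA, hYA⟩ := h
  exact IsCalibrated.moment_le hA hX hY (isCalibrated_of_ae_eq_condExp h𝓖 hA hXA)
    (isCalibrated_of_ae_eq_condExp h𝓗 hA hYA) hXY hk hS

end Coherent

/-! ### From graphs to coherent pairs -/

section GraphCoherent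

variable {α β : Type*} [MeasurableSpace α] [MeasurableSpace β] {μ : Measure α} {ν : Measure β}
  [IsProbabilityMeasure μ] [IsProbabilityMeasure ν]

lemma integral_snd_ae_eq_condExp_fst {h : α × β → ℝ} (hm : Measurable h)
    (hh : Integrable h (μ.prod ν)) :
    (fun p : α × β => ∫ t, h (p.1, t) ∂ν) =ᵐ[μ.prod ν]
      (μ.prod ν)[h | MeasurableSpace.comap Prod.fst inferInstance] := by
  have hsm : StronglyMeasurable fun s => ∫ t, h (s, t) ∂ν :=
    StronglyMeasurable.integral_prod_right (f := fun s t => h (s, t)) hm.stronglyMeasurable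
  have hint : Integrable (fun p : α × β => ∫ t, h (p.1, t) ∂ν) (μ.prod ν) :=
    hh.integral_prod_left.comp_fst ν
  refine ae_eq_condExp_of_forall_setIntegral_eq measurable_fst.comap_le hh
    (fun _ _ _ => hint.integrableOn) ?_
    (hsm.comp_measurable (comap_measurable _)).aestronglyMeasurable
  rintro _ ⟨B, hB, rfl⟩ -
  rw [← Set.prod_univ, setIntegral_prod _ hint.integrableOn, setIntegral_prod _ hh.integrableOn]
  simp

lemma integral_fst_ae_eq_condExp_snd {h : α × β → ℝ} (hm : Measurable h)
    (hh : Integrable h (μ.prod ν)) :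
    (fun p : α × β => ∫ s, h (s, p.2) ∂μ) =ᵐ[μ.prod ν]
      (μ.prod ν)[h | MeasurableSpace.comap Prod.snd inferInstance] := by
  have hsm : StronglyMeasurable fun t => ∫ s, h (s, t) ∂μ :=
    StronglyMeasurable.integral_prod_left (f := fun s t => h (s, t)) hm.stronglyMeasurable
  have hint : Integrable (fun p : α × β => ∫ s, h (s, p.2) ∂μ) (μ.prod ν) :=
    hh.integral_prod_right.comp_snd μ
  refine ae_eq_condExp_of_forall_setIntegral_eq measurable_snd.comap_le hh
    (fun _ _ _ => hint.integrableOn) ?_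
    (hsm.comp_measurable (comap_measurable _)).aestronglyMeasurable
  rintro _ ⟨B, hB, rfl⟩ -
  -- The order of integration is swapped so that the `μ`-average is the inner integral.
  rw [← Set.univ_prod, ← Measure.prod_restrict, integral_prod_symm, integral_prod_symm]
  · simp
  · rw [Measure.prod_restrict]; exact hh.integrableOn
  · rw [Measure.prod_restrict]; exact hint.integrableOn

lemma integral_uniformOfFintype {γ : Type*} [Fintype γ] [Nonempty γ] [MeasurableSpace γ]
    [MeasurableSingletonClass γ] (g : γ → ℝ) :
    ∫ c, g c ∂(PMF.uniformOfFintype γ).toMeasure = 1 / (Fintype.card γ : ℝ) * ∑ c, g c := by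
  rw [PMF.integral_eq_sum, Finset.mul_sum]
  simp

/-- Every bipartite graph is realised by an independent coherent pair: the event is the edge set
inside the square of the uniform law on `Fin n`. -/
lemma degreeSpread_mem_indepCoherentMoments (k : ℕ) {n : ℕ} (hn : 0 < n)
    {G : SimpleGraph (Fin n ⊕ Fin n)} (hG : G ∈ bipartiteGraphs n) :
    degreeSpread k n G ∈ indepCoherentMoments.{u} k := by
  classical
  -- `ULift` places the finite space in the universe `u` of the moment set.
  let γ := ULift.{u} (Fin n)
  let _ : MeasurableSpace γ := ⊤
  have : Nonempty γ := ⟨⟨⟨0, hn⟩⟩⟩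
  let μ : Measure γ := (PMF.uniformOfFintype γ).toMeasure
  let A : Set (γ × γ) := {p | G.Adj (Sum.inl p.1.down) (Sum.inr p.2.down)}
  let F : γ × γ → ℝ := A.indicator fun _ => 1
  let d : γ → ℝ := fun s => ∫ t, F (s, t) ∂μ
  let e : γ → ℝ := fun t => ∫ s, F (s, t) ∂μ
  have hF : Measurable F := measurable_of_countable _
  have hFi : Integrable F (μ.prod μ) := (integrable_const _).indicator (Set.to_countable A).measurableSet
  have hint : ∀ g : γ → ℝ, ∫ c, g c ∂μ = 1 / (n : ℝ) * ∑ i, g (ULift.up i) := fun g => by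
    rw [integral_uniformOfFintype, ← Equiv.ulift.symm.sum_comp]
    simp [γ]
  have hd : ∀ i : Fin n, d ⟨i⟩ = 1 / (n : ℝ) * G.degree (Sum.inl i) := fun i => by
    simp only [d, hint, degree_inl_of_mem_bipartiteGraphs hG]
    simp [F, A, Set.indicator_apply]
  have he : ∀ j : Fin n, e ⟨j⟩ = 1 / (n : ℝ) * G.degree (Sum.inr j) := fun j => by
    simp only [e, hint, degree_inr_of_mem_bipartiteGraphs hG]
    simp [F, A, Set.indicator_apply]
  refine ⟨γ × γ, inferInstance, μ.prod μ, inferInstance, fun p => d p.1, fun p => e p.2,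
    ⟨measurable_of_countable _, measurable_of_countable _, A, _, _,
      (Set.to_countable A).measurableSet, measurable_fst.comap_le, measurable_snd.comap_le,
      integral_snd_ae_eq_condExp_fst hF hFi, integral_fst_ae_eq_condExp_snd hF hFi⟩,
    indepFun_prod (measurable_of_countable _) (measurable_of_countable _), ?_⟩
  rw [integral_prod _ Integrable.of_finite, hint]
  -- The two uniform averages give `n⁻²` and the normalised degrees give `n⁻ᵏ`.
  simp only [hint, hd, he, ← mul_sub, abs_mul, mul_pow, ← Finset.mul_sum]
  unfold degreeSpread
  rw [abs_of_nonneg (by positivity : (0 : ℝ) ≤ 1 / (n : ℝ)), ← mul_assoc, ← mul_assoc]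
  congr 1
  have hn0 : (n : ℝ) ≠ 0 := by positivity
  rw [one_div_pow, pow_add]
  field_simp

end GraphCoherent

/-- The first three conjuncts say that the suprema in the last one are suprema of nonempty sets of
reals that are bounded above (for each `n` there is at least one bipartite graph, the empty one). -/
theorem mainTheorem3 (k : ℕ) (hk : 3 ≤ k) :
    (indepCoherentMoments.{u} k).Nonempty ∧
    BddAbove (indepCoherentMoments.{u} k) ∧
    BddAbove {v : ℝ | ∃ n : ℕ+, ∃ G ∈ bipartiteGraphs n, v = degreeSpread k n G} ∧
    sSup (indepCoherentMoments.{u} k) =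
      ⨆ n : ℕ+, ⨆ G : bipartiteGraphs n, degreeSpread k n (G : SimpleGraph (Fin n ⊕ Fin n)) := by
  have hub : ∀ (n : ℕ), 0 < n → ∀ G ∈ bipartiteGraphs n,
      degreeSpread k n G ≤ ⨆ n : ℕ+, ⨆ G : bipartiteGraphs n,
        degreeSpread k n (G : SimpleGraph (Fin n ⊕ Fin n)) := by
    intro n hn G hG
    have hne : ∀ m : ℕ+, Nonempty (bipartiteGraphs m) := fun m =>
      ⟨⟨_, bipartiteGraphOf_mem fun _ _ => False⟩⟩
    have hle : ∀ (m : ℕ+) (H : bipartiteGraphs m),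
        degreeSpread k m (H : SimpleGraph (Fin m ⊕ Fin m)) ≤ 1 := fun m H =>
      degreeSpread_le_one k m.pos H.2
    -- Real suprema of unbounded families default to `0`, so each level of the iterated supremum
    -- needs its own upper bound; `1` serves for both.
    refine le_trans (le_ciSup (f := fun H : bipartiteGraphs n => degreeSpread k n H.1)
      ⟨1, ?_⟩ ⟨G, hG⟩) (le_ciSup (f := fun m : ℕ+ => ⨆ H : bipartiteGraphs m,
        degreeSpread k m (H : SimpleGraph (Fin m ⊕ Fin m))) ⟨1, ?_⟩ ⟨n, hn⟩)
    · rintro _ ⟨H, rfl⟩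
      exact hle ⟨n, hn⟩ H
    · rintro _ ⟨m, rfl⟩
      have := hne m
      exact ciSup_le (hle m)
  have hmem : degreeSpread k 1 (bipartiteGraphOf fun _ _ => False) ∈ indepCoherentMoments.{u} k :=
    degreeSpread_mem_indepCoherentMoments k one_pos (bipartiteGraphOf_mem _)
  have hmom : ∀ v ∈ indepCoherentMoments.{u} k, v ≤ ⨆ n : ℕ+, ⨆ G : bipartiteGraphs n,
      degreeSpread k n (G : SimpleGraph (Fin n ⊕ Fin n)) := by
    rintro _ ⟨Ω, _, P, _, X, Y, hco, hXY, rfl⟩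
    exact hco.moment_le hXY (by omega) hub
  refine ⟨⟨_, hmem⟩, ⟨_, hmom⟩, ⟨1, ?_⟩, le_antisymm (csSup_le ⟨_, hmem⟩ hmom) ?_⟩
  · rintro _ ⟨n, G, hG, rfl⟩
    exact degreeSpread_le_one k n.pos hG
  · refine ciSup_le fun n => ?_
    have : Nonempty (bipartiteGraphs n) := ⟨⟨_, bipartiteGraphOf_mem fun _ _ => False⟩⟩
    exact ciSup_le fun G =>
      le_csSup ⟨_, hmom⟩ (degreeSpread_mem_indepCoherentMoments k n.pos G.2)
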